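/- Call a nonincreasing sequence $\pi=(d_1,\dots,d_n)$ of nonnegative integers graphic if it is the degree sequence of a finite simple graph on $n$ vertices; such a graph is a realization of $\pi$. Write $\sigma(\pi)=d_1+\cdots+d_n$. For a graph $H$, let $\sigma(H,n)$ be the smallest even integer $l$ such that every $n$-term graphic sequence $\pi$ with all terms positive and $\sigma(\pi)\ge l$ has a realization containing $H$ as a subgraph. Let $K_{3,1,1}$ be the complete tripartite graph with parts of sizes $3,1,1$. Theorem 4.4. For $n=5$ and for every $n\ge 7$, $$\sigma(K_{3,1,1},n)=4n-2.$$ For $n=6$, if $\pi$ is a $6$-term graphic sequence with $\sigma(\pi)\ge 22$, then either $\pi$ has a realization containing $K_{3,1,1}$ as a subgraph or $\pi=(4,4,4,4,4,4)$. Moreover, $\sigma(K_{3,1,1},6)=26$. -/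

import Mathlib

/-- `G` is a realization of the sequence `d = (d 0, …, d (n-1))`: a simple graph of order `n` whose
degree sequence is `d`, the vertices being labelled by the positions in the sequence. -/
def IsRealization {n : ℕ} (G : SimpleGraph (Fin n)) (d : Fin n → ℕ) : Prop :=
  ∀ i, (G.neighborSet i).ncard = d i

/-- `d` is an `n`-term graphic sequence: a nonincreasing sequence of nonnegative integers which is
the degree sequence of a simple graph of order `n`. -/
def IsGraphic {n : ℕ} (d : Fin n → ℕ) : Prop :=
  Antitone d ∧ ∃ G : SimpleGraph (Fin n), IsRealization G d

/-- `d` has a realization that contains `H` as a (not necessarily induced) subgraph. -/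
def HasRealizationContaining {V : Type*} (H : SimpleGraph V) {n : ℕ} (d : Fin n → ℕ) : Prop :=
  ∃ G : SimpleGraph (Fin n), IsRealization G d ∧ H.IsContained G

/-- The even `l` such that every `n`-term positive graphic sequence with sum at least `l` has a
realization containing `H`. -/
def sigmaSet {V : Type*} (H : SimpleGraph V) (n : ℕ) : Set ℕ :=
  {l | Even l ∧ ∀ d : Fin n → ℕ, IsGraphic d → (∀ i, 0 < d i) → l ≤ ∑ i, d i →
    HasRealizationContaining H d}

/-- `σ(H, n)`: the smallest even `l` such that every `n`-term positive graphic sequence with sum at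
least `l` has a realization containing `H`. -/
noncomputable def sigma {V : Type*} (H : SimpleGraph V) (n : ℕ) : ℕ :=
  sInf (sigmaSet H n)

/-- The minimum defining `σ(H, n)` is always attained, so `sigma` never takes a junk value. -/
theorem sigma_isLeast {V : Type*} (H : SimpleGraph V) (n : ℕ) :
    IsLeast (sigmaSet H n) (sigma H n) := by
  have hne : (sigmaSet H n).Nonempty := by
    refine ⟨2 * (n * n + 1), even_two_mul _, ?_⟩
    rintro d ⟨-, G, hG⟩ - hsum
    exfalso
    have hle : ∑ i, d i ≤ ∑ _i : Fin n, n := by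
      refine Finset.sum_le_sum fun i _ => ?_
      rw [← hG i]
      simpa [Set.ncard_univ] using Set.ncard_le_ncard (Set.subset_univ (G.neighborSet i))
    simp only [Finset.sum_const, Finset.card_univ, Fintype.card_fin, smul_eq_mul] at hle
    omega
  exact ⟨Nat.sInf_mem hne, fun _ hl => Nat.sInf_le hl⟩

/-- The complete tripartite graph `K_{3,1,1}`, with parts of sizes 3, 1 and 1. -/
def K311 : SimpleGraph (Σ i : Fin 3, Fin (![3, 1, 1] i)) :=
  SimpleGraph.completeMultipartiteGraph fun i : Fin 3 => Fin (![3, 1, 1] i)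

/-! `K_{3,1,1}` is the book of three triangles on a common edge. For the upper bound, induct on the
set of vertices still in play, with `u` a vertex of minimum degree `δ` among `n` of them.

If enough edges survive, delete `u`; the exception is a 4-regular rest on six vertices, where
switching one pair of edges creates a book. Otherwise counting leaves two cases. If `δ = 3` and the
degree sum is `4n - 2`, a dominating vertex gives a book, and `n ≤ 7` leaves a few explicit
sequences; for `n ≥ 8`, suppress `u`, that is, give one new edge-end to each of two of its
neighbours, and reinsert `u` into the resulting book graph by subdividing an edge off the book and
joining `u` to the third neighbour. If `G` is 4-regular, start from an explicit graph on seven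
vertices and add one vertex at a time, subdividing two edges off a book.

The lower bounds come from the wheel, in which only the hub has degree above three, and from the
4-regular graph on six vertices.
-/

open SimpleGraph

section Degree

variable {V : Type*} {G H : SimpleGraph V}

/-- The degree of `v` in `G`, as the `ncard` used in `IsRealization`, so that degrees of graphs
built by lattice operations need no decidability instances. -/
noncomputable def vdeg (G : SimpleGraph V) (v : V) : ℕ :=
  (G.neighborSet v).ncard

lemma isRealization_iff_vdeg_eq {n : ℕ} {G : SimpleGraph (Fin n)} {d : Fin n → ℕ} :
    IsRealization G d ↔ vdeg G = d :=
  funext_iff.symm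

lemma vdeg_eq_degree (v : V) [Fintype (G.neighborSet v)] : vdeg G v = G.degree v := by
  rw [vdeg, Set.ncard_eq_toFinset_card', ← G.card_neighborFinset_eq_degree, neighborFinset]

lemma vdeg_le_card {v : V} {s : Finset V} (h : ∀ w, G.Adj v w → w ∈ s) : vdeg G v ≤ s.card :=
  (Set.ncard_le_ncard (s := G.neighborSet v) (t := s) h).trans_eq (Set.ncard_coe_finset s)

lemma exists_adj_notMem_of_card_lt_vdeg {v : V} {s : Finset V} (h : s.card < vdeg G v) :
    ∃ w, G.Adj v w ∧ w ∉ s := by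
  by_contra! hs
  exact h.not_ge (vdeg_le_card hs)

lemma vdeg_edge [DecidableEq V] {a b : V} (h : a ≠ b) :
    vdeg (edge a b) = Pi.single a 1 + Pi.single b 1 := by
  have hset (v : V) : (edge a b).neighborSet v =
      if v = a then {b} else if v = b then {a} else ∅ := by
    ext w
    simp only [mem_neighborSet, edge_adj]
    split_ifs <;> simp only [Set.mem_singleton_iff, Set.mem_empty_iff_false] <;> grind
  funext v
  simp only [vdeg, hset, Pi.add_apply, Pi.single_apply]
  split_ifs <;> simp_all

lemma vdeg_map {W : Type*} (D : SimpleGraph W) (f : W ↪ V) (i : W) :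
    vdeg (D.map f) (f i) = vdeg D i := by
  have hset : (D.map f).neighborSet (f i) = f '' D.neighborSet i := by
    ext v
    simp
  rw [vdeg, hset, Set.ncard_image_of_injective _ f.injective, vdeg]

section Finite

variable [Finite V]

lemma card_le_vdeg {v : V} {s : Finset V} (h : ∀ w ∈ s, G.Adj v w) : s.card ≤ vdeg G v := by
  rw [← Set.ncard_coe_finset]
  exact Set.ncard_le_ncard (t := G.neighborSet v) h

lemma exists_mem_not_adj_of_vdeg_lt_card {v : V} {s : Finset V} (h : vdeg G v < s.card) :
    ∃ w ∈ s, ¬ G.Adj v w := by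
  by_contra! hs
  exact h.not_ge (card_le_vdeg hs)

lemma mem_iff_adj_of_forall_adj {v : V} {s : Finset V} (h : ∀ w ∈ s, G.Adj v w)
    (hs : vdeg G v ≤ s.card) {w : V} : w ∈ s ↔ G.Adj v w := by
  have heq : (s : Set V) = G.neighborSet v :=
    Set.eq_of_subset_of_ncard_le h (by rwa [Set.ncard_coe_finset])
  exact Set.ext_iff.1 heq w

lemma mem_iff_adj_of_forall_mem {v : V} {s : Finset V} (h : ∀ w, G.Adj v w → w ∈ s)
    (hs : s.card ≤ vdeg G v) {w : V} : w ∈ s ↔ G.Adj v w := by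
  have heq : G.neighborSet v = (s : Set V) :=
    Set.eq_of_subset_of_ncard_le h (by rwa [Set.ncard_coe_finset])
  exact (Set.ext_iff.1 heq w).symm

lemma exists_neighbors_of_vdeg (G : SimpleGraph V) (v : V) :
    ∃ N : Finset V, N.card = vdeg G v ∧ ∀ w, w ∈ N ↔ G.Adj v w :=
  ⟨(G.neighborSet v).toFinite.toFinset, (Set.ncard_eq_toFinset_card _ _).symm, by simp⟩

lemma vdeg_eq_zero_iff {v : V} : vdeg G v = 0 ↔ ∀ w, ¬ G.Adj v w := by
  rw [vdeg, Set.ncard_eq_zero, Set.eq_empty_iff_forall_notMem]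
  rfl

lemma not_adj_of_vdeg_eq_zero {v w : V} (h : vdeg G v = 0) : ¬ G.Adj v w :=
  vdeg_eq_zero_iff.1 h w

lemma vdeg_mono (h : G ≤ H) (v : V) : vdeg G v ≤ vdeg H v :=
  Set.ncard_le_ncard fun _ hw => h hw

lemma mem_of_adj_of_vdeg_eq_zero {S : Finset V} (h0 : ∀ v ∉ S, vdeg G v = 0) {v w : V}
    (h : G.Adj v w) : w ∈ S := by
  by_contra hw
  exact not_adj_of_vdeg_eq_zero (h0 w hw) h.symm

lemma vdeg_sup (h : Disjoint G H) : vdeg (G ⊔ H) = vdeg G + vdeg H := by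
  funext v
  refine Set.ncard_union_eq (s := G.neighborSet v) (t := H.neighborSet v) ?_
  exact Set.disjoint_left.2 fun w hG hH =>
    Set.disjoint_left.1 (disjoint_edgeSet.2 h) (G.mem_edgeSet.2 hG) (H.mem_edgeSet.2 hH)

lemma vdeg_sdiff_add (h : H ≤ G) : vdeg (G \ H) + vdeg H = vdeg G := by
  rw [← vdeg_sup disjoint_sdiff_self_left, sdiff_sup_cancel h]

lemma vdeg_sup_edge [DecidableEq V] {a b : V} (hab : a ≠ b) (h : ¬ G.Adj a b) :
    vdeg (G ⊔ edge a b) = vdeg G + (Pi.single a 1 + Pi.single b 1) := by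
  rw [vdeg_sup ((disjoint_edge G).2 h), vdeg_edge hab]

lemma vdeg_sdiff_edge [DecidableEq V] {a b : V} (h : G.Adj a b) :
    vdeg (G \ edge a b) + (Pi.single a 1 + Pi.single b 1) = vdeg G := by
  rw [← vdeg_edge h.ne, vdeg_sdiff_add ((edge_le_iff G).2 (.inr h))]

lemma vdeg_sup_edge_sup_edge [DecidableEq V] {a b c d : V} (hab : a ≠ b) (hcd : c ≠ d)
    (hne : s(a, b) ≠ s(c, d)) (h : ¬ G.Adj a b) (h' : ¬ G.Adj c d) :
    vdeg (G ⊔ (edge a b ⊔ edge c d)) =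
      vdeg G + (Pi.single a 1 + Pi.single b 1) + (Pi.single c 1 + Pi.single d 1) := by
  rw [← sup_assoc, vdeg_sup_edge hcd, vdeg_sup_edge hab h]
  rintro (hG | hedge)
  exacts [h' hG, hne ((adj_edge a b).1 hedge).1]

lemma vdeg_deleteIncidenceSet_self (u : V) : vdeg (G.deleteIncidenceSet u) u = 0 :=
  vdeg_eq_zero_iff.2 fun _ h => (deleteIncidenceSet_adj.1 h).2.1 rfl

lemma vdeg_deleteIncidenceSet_eq_zero [DecidableEq V] {S : Finset V}
    (h0 : ∀ v ∉ S, vdeg G v = 0) {u v : V} (hv : v ∉ S.erase u) :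
    vdeg (G.deleteIncidenceSet u) v = 0 := by
  by_cases hvu : v = u
  · rw [hvu, vdeg_deleteIncidenceSet_self]
  · exact Nat.eq_zero_of_le_zero ((vdeg_mono (G.deleteIncidenceSet_le u) v).trans_eq
      (h0 v fun h => hv (Finset.mem_erase.2 ⟨hvu, h⟩)))

lemma vdeg_deleteIncidenceSet [DecidableEq V] {u : V} {N : Finset V}
    (hN : ∀ w, w ∈ N ↔ G.Adj u w) :
    vdeg (G.deleteIncidenceSet u) + (∑ w ∈ N, Pi.single w 1 + N.card • Pi.single u 1) =
      vdeg G := by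
  have hsum (v : V) : (∑ w ∈ N, Pi.single w 1 : V → ℕ) v = if v ∈ N then 1 else 0 := by
    simp [Finset.sum_apply, Pi.single_apply]
  funext v
  simp only [Pi.add_apply, hsum, Pi.smul_apply, Pi.single_apply]
  by_cases hvu : v = u
  · subst hvu
    have hvN : v ∉ N := fun h => ((hN v).1 h).ne rfl
    have hset : G.neighborSet v = N := Set.ext fun w => (hN w).symm
    rw [vdeg_deleteIncidenceSet_self, vdeg, hset, Set.ncard_coe_finset]
    simp [hvN]
  · have hdel : (G.deleteIncidenceSet u).neighborSet v = G.neighborSet v \ {u} := by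
      ext w
      simp [deleteIncidenceSet_adj, hvu]
    rw [vdeg, vdeg, hdel]
    split_ifs with hv
    · rw [← Set.ncard_sdiff_singleton_add_one (s := G.neighborSet v) (a := u) ((hN v).1 hv).symm]
      simp
    · rw [Set.sdiff_singleton_eq_self fun h => hv ((hN v).2 h.symm)]
      simp

lemma vdeg_map_of_notMem_range {W : Type*} (D : SimpleGraph W) (f : W ↪ V) {v : V}
    (hv : v ∉ Set.range f) : vdeg (D.map f) v = 0 := by
  rw [vdeg_eq_zero_iff]
  rintro w ⟨-, i, j, -, rfl, -⟩
  exact hv ⟨i, rfl⟩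

end Finite

section Fintype

variable [Fintype V]

lemma sum_vdeg_eq_two_mul_ncard_edgeSet (G : SimpleGraph V) :
    ∑ v, vdeg G v = 2 * G.edgeSet.ncard := by
  classical
  simp only [vdeg_eq_degree, sum_degrees_eq_twice_card_edges, ← coe_edgeFinset,
    Set.ncard_coe_finset]

lemma sum_vdeg_deleteIncidenceSet (G : SimpleGraph V) (u : V) :
    ∑ v, vdeg (G.deleteIncidenceSet u) v + 2 * vdeg G u = ∑ v, vdeg G v := by
  classical
  obtain ⟨N, hcard, hN⟩ := exists_neighbors_of_vdeg G u
  have hsum := congrArg (fun d => ∑ v, d v) (vdeg_deleteIncidenceSet hN)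
  simp only [Pi.add_apply, Finset.sum_add_distrib, Finset.sum_apply, Pi.smul_apply] at hsum
  rw [Finset.sum_comm] at hsum
  simp only [Finset.sum_pi_single', Finset.mem_univ, ↓reduceIte, Finset.sum_const, smul_eq_mul,
    mul_one, ← Finset.mul_sum] at hsum
  omega

end Fintype

end Degree

section Book

variable {V W : Type*} {G H : SimpleGraph V} {a b : V} {s : Finset V} {k : ℕ}

/-- The edge `ab` together with the common neighbours `s` of its endpoints: a triangular book with
spine `ab`, one page for each element of `s`. The book with `k` pages is `K_{k,1,1}`. -/
structure IsBook (G : SimpleGraph V) (a b : V) (s : Finset V) : Prop where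
  adj : G.Adj a b
  left : ∀ x ∈ s, G.Adj a x
  right : ∀ x ∈ s, G.Adj b x

/-- `G` contains the triangular book with `k` pages. -/
def HasBook (k : ℕ) (G : SimpleGraph V) : Prop :=
  ∃ a b s, s.card = k ∧ IsBook G a b s

/-- Some graph with degree function `d` contains the triangular book with `k` pages: the sequence
`d` is potentially `K_{k,1,1}`-graphic. -/
def PotentiallyHasBook (k : ℕ) (d : V → ℕ) : Prop :=
  ∃ G, vdeg G = d ∧ HasBook k G

lemma HasBook.potentially (h : HasBook k G) : PotentiallyHasBook k (vdeg G) :=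
  ⟨G, rfl, h⟩

lemma IsBook.symm (h : IsBook G a b s) : IsBook G b a s :=
  ⟨h.adj.symm, h.right, h.left⟩

lemma IsBook.mono (hGH : G ≤ H) (h : IsBook G a b s) : IsBook H a b s :=
  ⟨hGH h.adj, fun x hx => hGH (h.left x hx), fun x hx => hGH (h.right x hx)⟩

lemma HasBook.mono (hGH : G ≤ H) : HasBook k G → HasBook k H := fun ⟨a, b, s, hs, h⟩ =>
  ⟨a, b, s, hs, h.mono hGH⟩

lemma HasBook.map (f : V ↪ W) : HasBook k G → HasBook k (G.map f) := by
  rintro ⟨a, b, s, hs, h⟩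
  refine ⟨f a, f b, s.map f, by rwa [Finset.card_map], (G.map_adj_apply).2 h.adj, ?_, ?_⟩ <;>
    simp only [Finset.forall_mem_map, map_adj_apply]
  exacts [h.left, h.right]

lemma IsBook.left_notMem (h : IsBook G a b s) : a ∉ s := fun ha => (h.left a ha).ne rfl

lemma IsBook.right_notMem (h : IsBook G a b s) : b ∉ s := h.symm.left_notMem

lemma IsBook.card_lt_vdeg [Finite V] (h : IsBook G a b s) : s.card < vdeg G a := by
  classical
  rw [Nat.lt_iff_add_one_le, ← Finset.card_insert_of_notMem h.right_notMem]
  exact card_le_vdeg ((Finset.forall_mem_insert ..).2 ⟨h.adj, h.left⟩)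

lemma HasBook.exists_lt_vdeg [Finite V] (h : HasBook k G) :
    ∃ a b, a ≠ b ∧ k < vdeg G a ∧ k < vdeg G b := by
  obtain ⟨a, b, s, rfl, h⟩ := h
  exact ⟨a, b, h.adj.ne, h.card_lt_vdeg, h.symm.card_lt_vdeg⟩

-- The spine already has full degree, so a vertex off the book has only the `k` pages to be
-- adjacent to.
lemma not_hasBook_of_vdeg_eq [Fintype V] (hV : Fintype.card V = k + 3)
    (hG : ∀ v, vdeg G v = k + 1) : ¬ HasBook k G := by
  classical
  rintro ⟨a, b, s, rfl, h⟩
  have hcard : (insert a (insert b s)).card < Fintype.card V := by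
    have h1 := Finset.card_insert_le a (insert b s)
    have h2 := Finset.card_insert_le b s
    omega
  obtain ⟨w, -, hw⟩ := Finset.exists_mem_notMem_of_card_lt_card hcard
  simp only [Finset.mem_insert, not_or] at hw
  obtain ⟨hwa, hwb, hws⟩ := hw
  have not_adj_spine {c d : V} (hs : IsBook G c d s) (hwd : w ≠ d) : ¬ G.Adj c w := by
    rw [← mem_iff_adj_of_forall_adj ((Finset.forall_mem_insert d s _).2 ⟨hs.adj, hs.left⟩)
      (by rw [hG, Finset.card_insert_of_notMem hs.right_notMem])]
    simp [hwd, hws]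
  have hle : vdeg G w ≤ (Finset.univ \ {a, b, w}).card := by
    refine vdeg_le_card fun v hv => ?_
    have hva : v ≠ a := fun e => not_adj_spine h hwb (e ▸ hv.symm)
    have hvb : v ≠ b := fun e => not_adj_spine h.symm hwa (e ▸ hv.symm)
    simp [hva, hvb, hv.ne']
  rw [hG, Finset.card_univ_sdiff, hV, Finset.card_eq_three.2 ⟨a, b, w, h.adj.ne, Ne.symm hwa,
    Ne.symm hwb, rfl⟩] at hle
  omega

lemma HasBook.k311_isContained (h : HasBook 3 G) : K311.IsContained G := by
  obtain ⟨a, b, s, hs, h⟩ := h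
  let e : Fin 3 ≃ s := (s.equivFinOfCardEq hs).symm
  let f : (Σ i : Fin 3, Fin (![3, 1, 1] i)) → V
    | ⟨0, j⟩ => e j
    | ⟨1, _⟩ => a
    | ⟨2, _⟩ => b
  have hf : ∀ {p q}, K311.Adj p q → G.Adj (f p) (f q)
    | ⟨0, _⟩, ⟨0, _⟩, hne => absurd rfl hne
    | ⟨0, j⟩, ⟨1, _⟩, _ => (h.left _ (e j).2).symm
    | ⟨0, j⟩, ⟨2, _⟩, _ => (h.right _ (e j).2).symm
    | ⟨1, _⟩, ⟨0, j⟩, _ => h.left _ (e j).2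
    | ⟨1, _⟩, ⟨1, _⟩, hne => absurd rfl hne
    | ⟨1, _⟩, ⟨2, _⟩, _ => h.adj
    | ⟨2, _⟩, ⟨0, j⟩, _ => h.right _ (e j).2
    | ⟨2, _⟩, ⟨1, _⟩, _ => h.adj.symm
    | ⟨2, _⟩, ⟨2, _⟩, hne => absurd rfl hne
  refine ⟨Hom.toCopy ⟨f, hf⟩ ?_⟩
  rintro ⟨i, j⟩ ⟨i', j'⟩ heq
  obtain rfl : i = i' := by
    by_contra hne
    exact (hf (p := ⟨i, j⟩) (q := ⟨i', j'⟩) hne).ne heq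
  match i, j, j', heq with
  | 0, j, j', heq => rw [e.injective (Subtype.ext heq)]
  | 1, j, j', _ => exact congrArg _ (Subsingleton.elim (α := Fin 1) j j')
  | 2, j, j', _ => exact congrArg _ (Subsingleton.elim (α := Fin 1) j j')

lemma hasBook_of_k311_isContained (h : K311.IsContained G) : HasBook 3 G := by
  obtain ⟨f⟩ := h
  have hf {p q : Σ i : Fin 3, Fin (![3, 1, 1] i)} (hpq : p.1 ≠ q.1) : G.Adj (f p) (f q) :=
    f.toHom.map_adj hpq
  let page : Fin 3 ↪ V := (Function.Embedding.sigmaMk 0).trans f.toEmbedding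
  refine ⟨f ⟨1, (0 : Fin 1)⟩, f ⟨2, (0 : Fin 1)⟩, Finset.univ.map page, by simp, ?_, ?_, ?_⟩
  · exact hf (by simp)
  all_goals
    intro x hx
    obtain ⟨j, -, rfl⟩ := Finset.mem_map.1 hx
    exact hf (q := ⟨0, j⟩) (by simp)

lemma k311_isContained_iff_hasBook : K311.IsContained G ↔ HasBook 3 G :=
  ⟨hasBook_of_k311_isContained, HasBook.k311_isContained⟩

end Book

section Reductions

variable {V : Type*} [Finite V] {G : SimpleGraph V} {S : Finset V} {u : V} {k : ℕ}

lemma vdeg_le_card_sub_one (h0 : ∀ v ∉ S, vdeg G v = 0) {v : V} (hv : v ∈ S) :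
    vdeg G v ≤ S.card - 1 := by
  classical
  rw [← Finset.card_erase_of_mem hv]
  exact vdeg_le_card fun w hw => Finset.mem_erase.2 ⟨hw.ne', mem_of_adj_of_vdeg_eq_zero h0 hw⟩

lemma hasBook_of_vdeg_eq_card_sub_one (hS : ∀ v ∉ S, vdeg G v = 0) {a : V} (ha : a ∈ S)
    (hdeg : vdeg G a = S.card - 1) (hsum : (k + 1) * (S.card - 1) < ∑ v ∈ S, vdeg G v) :
    HasBook k G := by
  classical
  have hdom : ∀ v ∈ S.erase a, G.Adj a v := fun v => (mem_iff_adj_of_forall_mem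
    (fun v hv => Finset.mem_erase.2 ⟨hv.ne', mem_of_adj_of_vdeg_eq_zero hS hv⟩)
    (by rw [Finset.card_erase_of_mem ha, hdeg])).1
  obtain ⟨b, hb, hkb⟩ : ∃ b ∈ S.erase a, k < vdeg G b := by
    by_contra! h
    have hle : ∑ v ∈ S.erase a, vdeg G v ≤ (S.erase a).card • k :=
      Finset.sum_le_card_nsmul _ _ _ h
    rw [Finset.card_erase_of_mem ha, smul_eq_mul] at hle
    have hsplit : vdeg G a + ∑ v ∈ S.erase a, vdeg G v = ∑ v ∈ S, vdeg G v :=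
      Finset.add_sum_erase S (vdeg G) ha
    rw [hdeg] at hsplit
    rw [add_mul, mul_comm k, one_mul] at hsum
    omega
  obtain ⟨N, hNcard, hN⟩ := exists_neighbors_of_vdeg G b
  have haN : a ∈ N := (hN a).2 (hdom b hb).symm
  obtain ⟨s, hsN, hs⟩ := Finset.exists_subset_card_eq
    (s := N.erase a) (n := k) (by rw [Finset.card_erase_of_mem haN, hNcard]; omega)
  refine ⟨a, b, s, hs, hdom b hb, fun x hx => ?_, fun x hx => ?_⟩
  all_goals
    obtain ⟨hxa, hxN⟩ := Finset.mem_erase.1 (hsN hx)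
    have hbx := (hN x).1 hxN
  · exact hdom x (Finset.mem_erase.2 ⟨hxa, mem_of_adj_of_vdeg_eq_zero hS hbx⟩)
  · exact hbx

lemma PotentiallyHasBook.of_deleteIncidenceSet
    (h : PotentiallyHasBook k (vdeg (G.deleteIncidenceSet u))) :
    PotentiallyHasBook k (vdeg G) := by
  obtain ⟨H, hH, hbook⟩ := h
  have hdisj : Disjoint H (G \ G.deleteIncidenceSet u) := by
    have hu : vdeg H u = 0 := by rw [hH, vdeg_deleteIncidenceSet_self]
    refine disjoint_left.2 fun v w hvw hG => hG.2 ?_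
    refine deleteIncidenceSet_adj.2 ⟨hG.1, ?_, ?_⟩ <;> rintro rfl
    exacts [not_adj_of_vdeg_eq_zero hu hvw, not_adj_of_vdeg_eq_zero hu hvw.symm]
  refine ⟨H ⊔ G \ G.deleteIncidenceSet u, ?_, hbook.mono le_sup_left⟩
  rw [vdeg_sup hdisj, hH, add_comm, vdeg_sdiff_add (G.deleteIncidenceSet_le u)]

end Reductions

section Exchange

variable {V : Type*} {G : SimpleGraph V} {u : V} {N T S : Finset V} {k : ℕ}

lemma hasBook_of_isClique (hN : ∀ w, w ∈ N ↔ G.Adj u w) (hclique : G.IsClique N) {v x y : V}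
    (hvu : v ≠ u) (hvN : v ∉ N) (hx : x ∈ N) (hy : y ∈ N) (hxy : x ≠ y) (hvx : G.Adj v x)
    (hvy : G.Adj v y) : HasBook N.card G := by
  classical
  have huN : u ∉ N := fun h => ((hN u).1 h).ne rfl
  have hpages {c c' : V} (hc : c ∈ N) (hvc : G.Adj v c) :
      ∀ w ∈ insert u (insert v (N \ {c, c'})), G.Adj c w := by
    intro w hw
    simp only [Finset.mem_insert, Finset.mem_sdiff, not_or] at hw
    obtain rfl | rfl | ⟨hwN, hwc, -⟩ := hw
    exacts [((hN c).1 hc).symm, hvc.symm, hclique hc hwN (Ne.symm hwc)]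
  refine ⟨x, y, insert u (insert v (N \ {x, y})), ?_, hclique hx hy hxy, hpages hx hvx, ?_⟩
  · have := Finset.card_sdiff_add_card_eq_card (s := {x, y}) (t := N)
      (by simp [Finset.insert_subset_iff, hx, hy])
    rw [Finset.card_pair hxy] at this
    rw [Finset.card_insert_of_notMem (by simp [huN, hvu.symm]),
      Finset.card_insert_of_notMem (by simp [hvN])]
    omega
  · rw [Finset.pair_comm]
    exact hpages hy hvy

variable [Finite V]

lemma vdeg_switch {a b c d : V} (hab : G.Adj a b) (hcd : G.Adj c d)
    (hac : ¬ G.Adj a c) (hbd : ¬ G.Adj b d) (hne : a ≠ c) (hne' : b ≠ d) :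
    vdeg (G \ (edge a b ⊔ edge c d) ⊔ (edge a c ⊔ edge b d)) = vdeg G := by
  classical
  have hcd' : (G \ edge a b).Adj c d := by
    refine ⟨hcd, fun he => ?_⟩
    obtain ⟨⟨rfl, -⟩ | ⟨rfl, rfl⟩, -⟩ := (edge_adj ..).1 he
    exacts [hne rfl, hac hab]
  have hac' : ¬ ((G \ edge a b) \ edge c d).Adj a c := fun h => hac h.1.1
  have hbd' : ¬ ((G \ edge a b) \ edge c d).Adj b d := fun h => hbd h.1.1
  have hedges : s(a, c) ≠ s(b, d) := by
    have := hab.ne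
    rw [Ne, Sym2.eq_iff]
    grind
  rw [← sdiff_sdiff, vdeg_sup_edge_sup_edge hne hne' hedges hac' hbd', ← vdeg_sdiff_edge hab,
    ← vdeg_sdiff_edge hcd']
  abel

lemma adj_of_not_adj_of_card_le {x x' : V} (hx : x ∈ T) (hx' : x' ∈ T) (hne : x ≠ x')
    (hT : ∀ v, G.Adj x v → v ∈ T) (hcard : T.card ≤ vdeg G x + 2) (hxx' : ¬ G.Adj x x') :
    ∀ v ∈ T, v ≠ x → v ≠ x' → G.Adj x v := by
  classical
  intro v hv hvx hvx'
  refine (mem_iff_adj_of_forall_mem (s := T \ {x, x'}) (fun w hw => ?_) ?_).1 (by simp [*])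
  · have : w ≠ x' := by rintro rfl; exact hxx' hw
    simp [hT w hw, hw.ne', this]
  · rw [Finset.card_sdiff_of_subset (by simp [Finset.insert_subset_iff, hx, hx']),
      Finset.card_pair hne]
    omega

lemma exists_not_adj_of_vdeg_eq (hT : T.card = k + 3) (h0 : ∀ v ∉ T, vdeg G v = 0)
    (hreg : ∀ v ∈ T, vdeg G v = k + 1) {x : V} (hx : x ∈ T) :
    ∃ x' ∈ T, x' ≠ x ∧ ¬ G.Adj x x' ∧ ∀ v ∈ T, v ≠ x → v ≠ x' → G.Adj x v ∧ G.Adj x' v := by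
  classical
  obtain ⟨x', hx', hnadj⟩ := exists_mem_not_adj_of_vdeg_lt_card (G := G) (v := x)
    (s := T.erase x) (by rw [Finset.card_erase_of_mem hx, hreg x hx]; omega)
  obtain ⟨hne, hx'⟩ := Finset.mem_erase.1 hx'
  have hadj {c c' : V} (hc : c ∈ T) (hc' : c' ∈ T) (hne : c ≠ c') (h : ¬ G.Adj c c') :
      ∀ v ∈ T, v ≠ c → v ≠ c' → G.Adj c v :=
    adj_of_not_adj_of_card_le hc hc' hne (fun v hv => mem_of_adj_of_vdeg_eq_zero h0 hv)
      (by rw [hT, hreg c hc]) h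
  exact ⟨x', hx', hne, hnadj, fun v hv hvx hvx' => ⟨hadj hx hx' hne.symm hnadj v hv hvx hvx',
    hadj hx' hx hne (fun h => hnadj h.symm) v hv hvx' hvx⟩⟩

-- `S.erase u` induces the complement of a perfect matching. If `xx'` is one of its nonadjacent
-- pairs with `u ~ x`, then switching `ux`, `yx'` to `uy`, `xx'` turns `xx'` into the spine of a
-- book.
lemma potentiallyHasBook_of_deleteIncidenceSet_regular [DecidableEq V] (hS : S.card = k + 4)
    (hu : u ∈ S) (h0 : ∀ v ∉ S, vdeg G v = 0)
    (hreg : ∀ v ∈ S.erase u, vdeg (G.deleteIncidenceSet u) v = k + 1) (hpos : 0 < vdeg G u)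
    (hle : vdeg G u ≤ k + 1) : PotentiallyHasBook k (vdeg G) := by
  set T := S.erase u with hT
  have hTcard : T.card = k + 3 := by rw [hT, Finset.card_erase_of_mem hu, hS]; rfl
  have hTu {v : V} (hv : v ∈ T) : v ≠ u := Finset.ne_of_mem_erase hv
  have hKG {v w : V} (h : (G.deleteIncidenceSet u).Adj v w) : G.Adj v w :=
    G.deleteIncidenceSet_le u h
  obtain ⟨x, hux, -⟩ := exists_adj_notMem_of_card_lt_vdeg (s := ∅) (by simpa using hpos)
  have hxT : x ∈ T := Finset.mem_erase.2 ⟨hux.ne', mem_of_adj_of_vdeg_eq_zero h0 hux⟩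
  obtain ⟨x', hx'T, hx'x, hxx', hadj⟩ := exists_not_adj_of_vdeg_eq hTcard
    (fun v => vdeg_deleteIncidenceSet_eq_zero h0) hreg hxT
  obtain ⟨y, hy, huy⟩ := exists_mem_not_adj_of_vdeg_lt_card (G := G) (v := u)
    (s := T.erase x') (by rw [Finset.card_erase_of_mem hx'T]; omega)
  obtain ⟨hyx', hyT⟩ := Finset.mem_erase.1 hy
  have hyx : y ≠ x := fun h => huy (h ▸ hux)
  refine ⟨_, vdeg_switch hux (hKG (hadj y hyT hyx hyx').2).symm huy
    (fun h => hxx' (deleteIncidenceSet_adj.2 ⟨h, hTu hxT, hTu hx'T⟩)) (hTu hyT).symm hx'x.symm,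
    x, x', T \ {x, y, x'}, ?_, .inr (.inr ((adj_edge ..).2 ⟨rfl, hx'x.symm⟩)), ?_, ?_⟩
  · rw [Finset.card_sdiff_of_subset (by simp [Finset.insert_subset_iff, hxT, hyT, hx'T]), hTcard,
      Finset.card_eq_three.2 ⟨x, y, x', hyx.symm, hx'x.symm, hyx', rfl⟩]
    rfl
  all_goals
    intro v hv
    simp only [Finset.mem_sdiff, Finset.mem_insert, Finset.mem_singleton, not_or] at hv
    obtain ⟨hvT, hvx, hvy, hvx'⟩ := hv
    have hvu := hTu hvT
    have hpage := hadj v hvT hvx hvx'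
  · refine .inl ⟨hKG hpage.1, ?_⟩
    simp only [sup_adj, edge_adj]
    grind
  · refine .inl ⟨hKG hpage.2, ?_⟩
    simp only [sup_adj, edge_adj]
    grind

-- An edge `pq` off the clique `insert u N` is broken up, and its ends are joined to `i` and `j`.
lemma exists_suppression_of_isClique [DecidableEq V] (hN : ∀ w, w ∈ N ↔ G.Adj u w)
    (hclique : G.IsClique N) (hcard : 3 ≤ N.card) {p : V} (hpu : p ≠ u) (hpN : p ∉ N)
    (hp : 2 ≤ vdeg G p) (hbook : ¬ HasBook N.card G) :
    ∃ i ∈ N, ∃ j ∈ N, i ≠ j ∧ ∃ K,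
      vdeg K = vdeg (G.deleteIncidenceSet u) + (Pi.single i 1 + Pi.single j 1) := by
  have hone {v : V} (hvu : v ≠ u) (hvN : v ∉ N) {s : Finset V} (hsN : s ⊆ N) (hs : 2 ≤ s.card) :
      ∃ x ∈ s, ¬ G.Adj v x := by
    obtain ⟨x, hx, y, hy, hxy⟩ := Finset.one_lt_card.1 hs
    by_contra! h
    exact hbook (hasBook_of_isClique hN hclique hvu hvN (hsN hx) (hsN hy) hxy (h x hx) (h y hy))
  obtain ⟨q, hpq, hqN⟩ : ∃ q, G.Adj p q ∧ q ∉ N := by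
    by_contra! h
    obtain ⟨M, hMcard, hM⟩ := exists_neighbors_of_vdeg G p
    obtain ⟨x, hxM, hpx⟩ := hone hpu hpN (fun x hx => h x ((hM x).1 hx)) (hp.trans_eq hMcard.symm)
    exact hpx ((hM x).1 hxM)
  have hqu : q ≠ u := fun h => hpN ((hN p).2 (h ▸ hpq.symm))
  obtain ⟨i, hi, hpi⟩ := hone hpu hpN subset_rfl (by omega)
  obtain ⟨j, hj, hqj⟩ := hone hqu hqN (N.erase_subset i)
    (by rw [Finset.card_erase_of_mem hi]; omega)
  obtain ⟨hji, hj⟩ := Finset.mem_erase.1 hj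
  have hip : i ≠ p := fun h => hpN (h ▸ hi)
  have hjq : j ≠ q := fun h => hqN (h ▸ hj)
  refine ⟨i, hi, j, hj, hji.symm,
    G.deleteIncidenceSet u \ edge p q ⊔ (edge i p ⊔ edge j q), ?_⟩
  have hne : s(i, p) ≠ s(j, q) := by
    have := hpq.ne
    rw [Ne, Sym2.eq_iff]
    grind
  have hip' : ¬ (G.deleteIncidenceSet u \ edge p q).Adj i p := fun h =>
    hpi (G.deleteIncidenceSet_le u h.1).symm
  have hjq' : ¬ (G.deleteIncidenceSet u \ edge p q).Adj j q := fun h =>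
    hqj (G.deleteIncidenceSet_le u h.1).symm
  rw [vdeg_sup_edge_sup_edge hip hjq hne hip' hjq',
    ← vdeg_sdiff_edge (deleteIncidenceSet_adj.2 ⟨hpq, hpu, hqu⟩)]
  abel

lemma exists_suppression [DecidableEq V] (hN : ∀ w, w ∈ N ↔ G.Adj u w) (hcard : 3 ≤ N.card)
    (hS : N.card + 2 ≤ S.card) (hdeg : ∀ v ∈ S, 2 ≤ vdeg G v) (hbook : ¬ HasBook N.card G) :
    ∃ i ∈ N, ∃ j ∈ N, i ≠ j ∧ ∃ K,
      vdeg K = vdeg (G.deleteIncidenceSet u) + (Pi.single i 1 + Pi.single j 1) := by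
  by_cases hclique : G.IsClique N
  · obtain ⟨p, hpS, hp⟩ := Finset.exists_mem_notMem_of_card_lt_card
      (s := insert u N) (t := S) ((Finset.card_insert_le u N).trans_lt (by omega))
    rw [Finset.mem_insert, not_or] at hp
    exact exists_suppression_of_isClique hN hclique hcard hp.1 hp.2 (hdeg p hpS) hbook
  · obtain ⟨i, hi, j, hj, hij, hnadj⟩ : ∃ i ∈ N, ∃ j ∈ N, i ≠ j ∧ ¬ G.Adj i j := by
      simpa [IsClique, Set.Pairwise] using hclique
    exact ⟨i, hi, j, hj, hij, _, vdeg_sup_edge hij fun h =>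
      hnadj (G.deleteIncidenceSet_le u h)⟩

end Exchange

section Explicit

variable {V W : Type*} {d : V → ℕ} {S : Finset V} {k : ℕ}

lemma PotentiallyHasBook.of_comp [Finite V] (f : W ↪ V) (h0 : ∀ v ∉ Set.range f, d v = 0)
    (h : PotentiallyHasBook k (d ∘ f)) : PotentiallyHasBook k d := by
  obtain ⟨G, hG, hbook⟩ := h
  refine ⟨G.map f, funext fun v => ?_, hbook.map f⟩
  by_cases hv : v ∈ Set.range f
  · obtain ⟨i, rfl⟩ := hv
    rw [vdeg_map, hG, Function.comp_apply]
  · rw [vdeg_map_of_notMem_range G f hv, h0 v hv]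

lemma exists_embedding_monotone_comp (d : V → ℕ) {n : ℕ} (hS : S.card = n) :
    ∃ f : Fin n ↪ V, Finset.univ.map f = S ∧ Monotone (d ∘ f) := by
  let e : Fin n ≃ S := (S.equivFinOfCardEq hS).symm
  refine ⟨((Tuple.sort fun i => d (e i)).trans e).toEmbedding.trans (.subtype _), ?_,
    Tuple.monotone_sort fun i => d (e i)⟩
  refine Finset.eq_of_subset_of_card_le (fun v hv => ?_) (by simp [hS])
  obtain ⟨i, -, rfl⟩ := Finset.mem_map.1 hv
  exact (e (Tuple.sort _ i)).2

lemma potentiallyHasBook_of_forall_monotone [Fintype V] (h0 : ∀ v ∉ S, d v = 0) {n : ℕ}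
    (hS : S.card = n) {P : ℕ → Prop} (hP : ∀ v ∈ S, P (d v))
    (h : ∀ d' : Fin n → ℕ, Monotone d' → (∀ i, P (d' i)) → ∑ i, d' i = ∑ v, d v →
      PotentiallyHasBook k d') : PotentiallyHasBook k d := by
  obtain ⟨f, rfl, hmono⟩ := exists_embedding_monotone_comp d hS
  refine .of_comp f (fun v hv => h0 v (by simpa using hv)) (h _ hmono (fun i => hP _ ?_) ?_)
  · simp
  · rw [← Finset.sum_subset (Finset.subset_univ _) fun v _ hv => h0 v hv, Finset.sum_map]
    rfl

lemma potentiallyHasBook_334444 : PotentiallyHasBook 3 ![3, 3, 4, 4, 4, 4] :=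
  ⟨fromEdgeSet (V := Fin 6) ({s(0, 1), s(0, 2), s(0, 3), s(1, 4), s(1, 5), s(2, 3), s(2, 4),
      s(2, 5), s(3, 4), s(3, 5), s(4, 5)} : Finset (Sym2 (Fin 6))),
    funext fun v => (vdeg_eq_degree v).trans (by decide +revert), 2, 3, {0, 4, 5}, rfl,
    by decide, by decide, by decide⟩

lemma potentiallyHasBook_3333455 : PotentiallyHasBook 3 ![3, 3, 3, 3, 4, 5, 5] :=
  ⟨fromEdgeSet (V := Fin 7) ({s(0, 1), s(0, 2), s(0, 4), s(1, 5), s(1, 6), s(2, 5), s(2, 6),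
      s(3, 4), s(3, 5), s(3, 6), s(4, 5), s(4, 6), s(5, 6)} : Finset (Sym2 (Fin 7))),
    funext fun v => (vdeg_eq_degree v).trans (by decide +revert), 5, 6, {1, 2, 3}, rfl,
    by decide, by decide, by decide⟩

lemma potentiallyHasBook_3334445 : PotentiallyHasBook 3 ![3, 3, 3, 4, 4, 4, 5] :=
  ⟨fromEdgeSet (V := Fin 7) ({s(0, 1), s(0, 2), s(0, 3), s(1, 4), s(1, 6), s(2, 5), s(2, 6),
      s(3, 4), s(3, 5), s(3, 6), s(4, 5), s(4, 6), s(5, 6)} : Finset (Sym2 (Fin 7))),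
    funext fun v => (vdeg_eq_degree v).trans (by decide +revert), 4, 6, {1, 3, 5}, rfl,
    by decide, by decide, by decide⟩

lemma potentiallyHasBook_3344444 : PotentiallyHasBook 3 ![3, 3, 4, 4, 4, 4, 4] :=
  ⟨fromEdgeSet (V := Fin 7) ({s(0, 1), s(0, 2), s(0, 3), s(1, 2), s(1, 4), s(2, 5), s(2, 6),
      s(3, 4), s(3, 5), s(3, 6), s(4, 5), s(4, 6), s(5, 6)} : Finset (Sym2 (Fin 7))),
    funext fun v => (vdeg_eq_degree v).trans (by decide +revert), 5, 6, {2, 3, 4}, rfl,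
    by decide, by decide, by decide⟩

lemma potentiallyHasBook_4444444 : PotentiallyHasBook 3 (fun _ : Fin 7 => 4) :=
  ⟨fromEdgeSet (V := Fin 7) ({s(0, 1), s(0, 2), s(0, 3), s(0, 4), s(1, 2), s(1, 3), s(1, 4),
      s(2, 5), s(2, 6), s(3, 5), s(3, 6), s(4, 5), s(4, 6), s(5, 6)} : Finset (Sym2 (Fin 7))),
    funext fun v => (vdeg_eq_degree v).trans (by decide +revert), 0, 1, {2, 3, 4}, rfl,
    by decide, by decide, by decide⟩

lemma potentiallyHasBook_of_sum_eq_twenty_two {d : Fin 6 → ℕ} (hd : Monotone d)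
    (hbound : ∀ i, 3 ≤ d i ∧ d i ≤ 4) (hsum : ∑ i, d i = 22) : PotentiallyHasBook 3 d := by
  suffices h : d = ![3, 3, 4, 4, 4, 4] from h ▸ potentiallyHasBook_334444
  obtain ⟨a, b, c, e, f, g, rfl⟩ : ∃ a b c e f g, d = ![a, b, c, e, f, g] :=
    ⟨_, _, _, _, _, _, (FinVec.etaExpand_eq d).symm⟩
  simp only [monotone_vecCons, Matrix.cons_val_zero] at hd
  simp only [Fin.forall_fin_succ, Matrix.cons_val_zero, Matrix.cons_val_succ] at hbound
  simp only [Fin.sum_univ_succ, Matrix.cons_val_zero, Matrix.cons_val_succ, Fin.sum_univ_zero]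
    at hsum
  grind

lemma potentiallyHasBook_of_sum_eq_twenty_six {d : Fin 7 → ℕ} (hd : Monotone d)
    (hbound : ∀ i, 3 ≤ d i ∧ d i ≤ 5) (hsum : ∑ i, d i = 26) : PotentiallyHasBook 3 d := by
  obtain h | h | h : d = ![3, 3, 3, 3, 4, 5, 5] ∨ d = ![3, 3, 3, 4, 4, 4, 5] ∨
      d = ![3, 3, 4, 4, 4, 4, 4] := by
    obtain ⟨a, b, c, e, f, g, h, rfl⟩ : ∃ a b c e f g h, d = ![a, b, c, e, f, g, h] :=
      ⟨_, _, _, _, _, _, _, (FinVec.etaExpand_eq d).symm⟩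
    simp only [monotone_vecCons, Matrix.cons_val_zero] at hd
    simp only [Fin.forall_fin_succ, Matrix.cons_val_zero, Matrix.cons_val_succ] at hbound
    simp only [Fin.sum_univ_succ, Matrix.cons_val_zero, Matrix.cons_val_succ, Fin.sum_univ_zero]
      at hsum
    grind
  exacts [h ▸ potentiallyHasBook_3333455, h ▸ potentiallyHasBook_3334445,
    h ▸ potentiallyHasBook_3344444]

end Explicit

section Subdivision

variable {V : Type*} {G : SimpleGraph V} {S : Finset V} {u w q z : V} {k : ℕ}

/-- The subdivision of the edge `wq` of `G` by the vertex `u`. -/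
def subdivide (G : SimpleGraph V) (u w q : V) : SimpleGraph V :=
  G \ edge w q ⊔ (edge u w ⊔ edge u q)

lemma IsBook.subdivide {a b : V} {s : Finset V} (h : IsBook G a b s) (hwa : w ≠ a) (hwb : w ≠ b)
    (hws : w ∉ s) : IsBook (subdivide G u w q) a b s := by
  have hle {x y : V} (hx : w ≠ x) (hy : w ≠ y) (hxy : G.Adj x y) :
      (_root_.subdivide G u w q).Adj x y := by
    refine .inl ⟨hxy, fun he => ?_⟩
    rcases (edge_adj ..).1 he with ⟨⟨rfl, -⟩ | ⟨-, rfl⟩, -⟩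
    exacts [hx rfl, hy rfl]
  have hpage {x : V} (hx : x ∈ s) : w ≠ x := fun e => hws (e ▸ hx)
  exact ⟨hle hwa hwb h.adj, fun x hx => hle hwa (hpage hx) (h.left x hx),
    fun x hx => hle hwb (hpage hx) (h.right x hx)⟩

lemma subdivide_adj {v : V} (huw : u ≠ w) (huq : u ≠ q) (hu : ∀ v, ¬ G.Adj u v) :
    (subdivide G u w q).Adj u v ↔ v = w ∨ v = q := by
  simp only [subdivide, sup_adj, sdiff_adj, edge_adj, hu]
  grind

lemma exists_mem_notMem_book (S s t : Finset V) (a b : V) (h : s.card + 2 + t.card < S.card) :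
    ∃ w ∈ S, w ∉ t ∧ w ≠ a ∧ w ≠ b ∧ w ∉ s := by
  classical
  have hcard : (insert a (insert b (s ∪ t))).card < S.card := by
    have h1 := Finset.card_insert_le a (insert b (s ∪ t))
    have h2 := Finset.card_insert_le b (s ∪ t)
    have h3 := Finset.card_union_le s t
    omega
  obtain ⟨w, hwS, hw⟩ := Finset.exists_mem_notMem_of_card_lt_card hcard
  simp only [Finset.mem_insert, Finset.mem_union, not_or] at hw
  exact ⟨w, hwS, hw.2.2.2, hw.1, hw.2.1, hw.2.2.1⟩

variable [Finite V]

lemma vdeg_subdivide [DecidableEq V] (h : G.Adj w q) (hw : u ≠ w) (hq : u ≠ q)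
    (huw : ¬ G.Adj u w) (huq : ¬ G.Adj u q) :
    vdeg (subdivide G u w q) = vdeg G + 2 • Pi.single u 1 := by
  have hne : s(u, w) ≠ s(u, q) := fun he => h.ne (Sym2.congr_right.1 he)
  have huw' : ¬ (G \ edge w q).Adj u w := fun hadj => huw hadj.1
  have huq' : ¬ (G \ edge w q).Adj u q := fun hadj => huq hadj.1
  rw [subdivide, vdeg_sup_edge_sup_edge hw hq hne huw' huq', ← vdeg_sdiff_edge h]
  module

lemma HasBook.potentially_add_single [DecidableEq V] (hbook : HasBook k G) (hu : vdeg G u = 0)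
    (huz : u ≠ z) (hzS : z ∉ S) (hS : k + 2 < S.card) (hdeg : ∀ w ∈ S, 2 ≤ vdeg G w) :
    PotentiallyHasBook k (vdeg G + (Pi.single z 1 + 3 • Pi.single u 1)) := by
  obtain ⟨a, b, s, rfl, h⟩ := hbook
  have hu' (v : V) : ¬ G.Adj u v := not_adj_of_vdeg_eq_zero hu
  have hne {v v' : V} (hv : G.Adj v v') : u ≠ v := by rintro rfl; exact hu' _ hv
  obtain ⟨w, hwS, -, hwa, hwb, hws⟩ := exists_mem_notMem_book S s ∅ a b hS
  obtain ⟨q, hwq, hqz⟩ := exists_adj_notMem_of_card_lt_vdeg (G := G) (v := w) (s := {z})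
    (hdeg w hwS)
  have huz' : ¬ (subdivide G u w q).Adj u z := by
    rw [subdivide_adj (hne hwq) (hne hwq.symm) hu']
    rintro (rfl | rfl)
    exacts [hzS hwS, hqz (Finset.mem_singleton_self _)]
  refine ⟨subdivide G u w q ⊔ edge u z, ?_, a, b, s, rfl,
    (h.subdivide hwa hwb hws).mono le_sup_left⟩
  rw [vdeg_sup_edge huz huz', vdeg_subdivide hwq (hne hwq) (hne hwq.symm) (hu' w) (hu' q)]
  module

lemma HasBook.potentially_add_single_four [DecidableEq V] (hbook : HasBook k G)
    (hu : vdeg G u = 0) (hS : k + 3 < S.card) (hdeg : ∀ w ∈ S, 3 ≤ vdeg G w) :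
    PotentiallyHasBook k (vdeg G + 4 • Pi.single u 1) := by
  obtain ⟨a, b, s, rfl, h⟩ := hbook
  have hu' (v : V) : ¬ G.Adj u v := not_adj_of_vdeg_eq_zero hu
  have hne {v v' : V} (hv : G.Adj v v') : u ≠ v := by rintro rfl; exact hu' _ hv
  obtain ⟨w, hwS, -, hwa, hwb, hws⟩ := exists_mem_notMem_book S s ∅ a b (Nat.lt_of_succ_lt hS)
  obtain ⟨w', hwS', hww', hwa', hwb', hws'⟩ := exists_mem_notMem_book S s {w} a b hS
  obtain ⟨q, hwq, hqw'⟩ := exists_adj_notMem_of_card_lt_vdeg (G := G) (v := w) (s := {w'})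
    (Nat.lt_of_succ_lt (hdeg w hwS))
  obtain ⟨q', hwq', hq'⟩ := exists_adj_notMem_of_card_lt_vdeg (G := G) (v := w') (s := {w, q})
    (Finset.card_le_two.trans_lt (hdeg w' hwS'))
  simp only [Finset.mem_insert, Finset.mem_singleton, not_or] at hww' hqw' hq'
  have huw' : ¬ (subdivide G u w q).Adj u w' := by
    rw [subdivide_adj (hne hwq) (hne hwq.symm) hu', not_or]
    exact ⟨hww', Ne.symm hqw'⟩
  have huq' : ¬ (subdivide G u w q).Adj u q' := by
    rwa [subdivide_adj (hne hwq) (hne hwq.symm) hu', not_or]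
  have hadj : (subdivide G u w q).Adj w' q' := by
    refine .inl ⟨hwq', fun he => ?_⟩
    obtain ⟨⟨rfl, -⟩ | ⟨rfl, -⟩, -⟩ := (edge_adj ..).1 he
    exacts [hww' rfl, hqw' rfl]
  refine ⟨subdivide (subdivide G u w q) u w' q', ?_, a, b, s, rfl,
    (h.subdivide hwa hwb hws).subdivide hwa' hwb' hws'⟩
  rw [vdeg_subdivide hadj (hne hwq') (hne hwq'.symm) huw' huq',
    vdeg_subdivide hwq (hne hwq) (hne hwq.symm) (hu' w) (hu' q)]
  module

lemma potentiallyHasBook_of_eq_four {d : V → ℕ} (hS : 7 ≤ S.card) (h0 : ∀ v ∉ S, d v = 0)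
    (h4 : ∀ v ∈ S, d v = 4) : PotentiallyHasBook 3 d := by
  classical
  obtain ⟨n, hn⟩ : ∃ n, S.card = n := ⟨_, rfl⟩
  rw [hn] at hS
  induction n, hS using Nat.le_induction generalizing S d with
  | base =>
    obtain ⟨f, rfl, -⟩ := exists_embedding_monotone_comp d hn
    refine .of_comp f (fun v hv => h0 v (by simpa using hv)) ?_
    convert potentiallyHasBook_4444444 with i
    exact h4 _ (Finset.mem_map_of_mem f (Finset.mem_univ i))
  | succ n hn7 ih =>
    obtain ⟨u, hu⟩ := Finset.card_pos.1 (hn.trans_gt n.succ_pos)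
    have hcard : (S.erase u).card = n := by rw [Finset.card_erase_of_mem hu, hn]; rfl
    obtain ⟨H, hH, hbook⟩ := ih (d := Function.update d u 0) (S := S.erase u)
      (by grind [Function.update_apply]) (by grind [Function.update_apply]) hcard
    have hd : vdeg H + 4 • Pi.single u 1 = d := by
      funext v
      by_cases hv : v = u
      · subst hv; simp [hH, h4 v hu]
      · simp [hH, hv]
    rw [← hd]
    refine hbook.potentially_add_single_four (by simp [hH]) (S := S.erase u) (by omega) ?_
    intro w hw
    obtain ⟨hwu, hwS⟩ := Finset.mem_erase.1 hw
    simp [hH, hwu, h4 w hwS]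

end Subdivision

section Main

variable {V : Type*} [Fintype V] {G : SimpleGraph V} {S : Finset V} {u : V} {k : ℕ}

lemma sum_vdeg_eq_sum_vdeg (h0 : ∀ v ∉ S, vdeg G v = 0) : ∑ v ∈ S, vdeg G v = ∑ v, vdeg G v :=
  Finset.sum_subset (Finset.subset_univ S) fun v _ hv => h0 v hv

lemma hasBook_of_card_eq (hS : S.card = k + 2) (h0 : ∀ v ∉ S, vdeg G v = 0)
    (hsum : (k + 1) ^ 2 < ∑ v, vdeg G v) : HasBook k G := by
  rw [← sum_vdeg_eq_sum_vdeg h0] at hsum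
  obtain ⟨a, ha, hka⟩ : ∃ a ∈ S, k < vdeg G a := by
    refine Finset.exists_lt_of_sum_lt ?_
    rw [Finset.sum_const, hS, smul_eq_mul]
    exact lt_of_le_of_lt (by ring_nf; omega) hsum
  refine hasBook_of_vdeg_eq_card_sub_one h0 ha
    ((vdeg_le_card_sub_one h0 ha).antisymm (by rwa [hS])) ?_
  rwa [hS, show k + 2 - 1 = k + 1 from rfl, ← sq]

lemma potentiallyHasBook_of_suppression [DecidableEq V] (hu : vdeg G u = 3) (hS : 8 ≤ S.card)
    (h0 : ∀ v ∉ S, vdeg G v = 0) (hmin : ∀ v ∈ S, 3 ≤ vdeg G v)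
    (ih : ∀ K : SimpleGraph V, (∀ v ∉ S.erase u, vdeg K v = 0) →
      ∑ v, vdeg K v + 4 = ∑ v, vdeg G v → PotentiallyHasBook 3 (vdeg K)) :
    PotentiallyHasBook 3 (vdeg G) := by
  obtain ⟨N, hNcard, hN⟩ := exists_neighbors_of_vdeg G u
  rw [hu] at hNcard
  by_cases hbook : HasBook N.card G
  · exact hNcard ▸ hbook.potentially
  obtain ⟨i, hi, j, hj, hij, K, hK⟩ := exists_suppression hN hNcard.ge (by omega)
    (fun v hv => Nat.le_of_succ_le (hmin v hv)) hbook
  obtain ⟨z, hz⟩ : ∃ z, (N.erase i).erase j = {z} := by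
    rw [← Finset.card_eq_one, Finset.card_erase_of_mem (Finset.mem_erase.2 ⟨hij.symm, hj⟩),
      Finset.card_erase_of_mem hi, hNcard]
  have hzN : z ∈ N := Finset.mem_of_mem_erase (Finset.mem_of_mem_erase
    (hz ▸ Finset.mem_singleton_self z))
  have huz : u ≠ z := ((hN z).1 hzN).ne
  have hG : vdeg K + (Pi.single z 1 + 3 • Pi.single u 1) = vdeg G := by
    rw [hK, ← vdeg_deleteIncidenceSet hN, hNcard, ← Finset.add_sum_erase _ _ hi,
      ← Finset.add_sum_erase _ _ (Finset.mem_erase.2 ⟨hij.symm, hj⟩), hz, Finset.sum_singleton]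
    abel
  have hval (v : V) := congrFun hG v
  have hKu : vdeg K u = 0 := by simpa [huz, hu] using hval u
  obtain ⟨H, hH, hHbook⟩ := ih K
    (fun v hv => by
      by_cases hvu : v = u
      · rw [hvu, hKu]
      · exact Nat.eq_zero_of_add_eq_zero_right
          ((hval v).trans (h0 v fun h => hv (Finset.mem_erase.2 ⟨hvu, h⟩))))
    (by simp [← hG, Finset.sum_add_distrib, ← Finset.mul_sum])
  rw [← hG, ← hH]
  refine hHbook.potentially_add_single (S := (S.erase u).erase z) (by rw [hH, hKu]) huz
    (Finset.notMem_erase z _) ?_ fun w hw => ?_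
  · have h1 := Finset.pred_card_le_card_erase (s := S) (a := u)
    have h2 := Finset.pred_card_le_card_erase (s := S.erase u) (a := z)
    omega
  · obtain ⟨hwz, hwu, hwS⟩ : w ≠ z ∧ w ≠ u ∧ w ∈ S := by simpa using hw
    have hw : vdeg K w = vdeg G w := by simpa [hwz, hwu] using hval w
    rw [hH, hw]
    exact Nat.le_of_succ_le (hmin w hwS)

lemma potentiallyHasBook_of_vdeg_eq_three [DecidableEq V] (hu : vdeg G u = 3) (hS : 6 ≤ S.card)
    (h0 : ∀ v ∉ S, vdeg G v = 0) (hmin : ∀ v ∈ S, 3 ≤ vdeg G v)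
    (hsum : ∑ v, vdeg G v + 2 = 4 * S.card)
    (ih : ∀ K : SimpleGraph V, 8 ≤ S.card → (∀ v ∉ S.erase u, vdeg K v = 0) →
      ∑ v, vdeg K v + 4 = ∑ v, vdeg G v → PotentiallyHasBook 3 (vdeg K)) :
    PotentiallyHasBook 3 (vdeg G) := by
  by_cases hdom : ∃ a ∈ S, vdeg G a = S.card - 1
  · obtain ⟨a, ha, hdeg⟩ := hdom
    exact (hasBook_of_vdeg_eq_card_sub_one h0 ha hdeg
      (by rw [sum_vdeg_eq_sum_vdeg h0]; omega)).potentially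
  push Not at hdom
  have hmax {v : V} (hv : v ∈ S) : vdeg G v ≤ S.card - 2 := by
    have := vdeg_le_card_sub_one h0 hv
    have := hdom v hv
    omega
  obtain h6 | h7 | h8 : S.card = 6 ∨ S.card = 7 ∨ 8 ≤ S.card := by omega
  · exact potentiallyHasBook_of_forall_monotone h0 h6 (P := fun m => 3 ≤ m ∧ m ≤ 4)
      (fun v hv => ⟨hmin v hv, (hmax hv).trans_eq (by rw [h6])⟩) fun d hd hbound hd_sum =>
      potentiallyHasBook_of_sum_eq_twenty_two hd hbound (by omega)
  · exact potentiallyHasBook_of_forall_monotone h0 h7 (P := fun m => 3 ≤ m ∧ m ≤ 5)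
      (fun v hv => ⟨hmin v hv, (hmax hv).trans_eq (by rw [h7])⟩) fun d hd hbound hd_sum =>
      potentiallyHasBook_of_sum_eq_twenty_six hd hbound (by omega)
  · exact potentiallyHasBook_of_suppression hu h8 h0 hmin fun K => ih K h8

lemma eq_three_or_eq_four_of_sum_lt {n δ m : ℕ} (hn : 2 ≤ n) (hlow : (n + 1) * δ ≤ 2 * m)
    (hle : 4 * (n + 1) ≤ 2 * m + 2) (hlt : 2 * m + 2 < 4 * n + 2 * δ) :
    δ = 3 ∧ 2 * m + 2 = 4 * (n + 1) ∨ δ = 4 ∧ 2 * m = 4 * (n + 1) := by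
  have hδ : δ ≤ 4 := by
    by_contra! h
    have hle' : 2 * m + 4 ≤ 4 * n + 2 * δ := by omega
    obtain ⟨i, rfl⟩ := Nat.exists_eq_add_of_le hn
    obtain ⟨j, rfl⟩ := Nat.exists_eq_add_of_le h
    nlinarith [Nat.zero_le (i * j)]
  interval_cases δ <;> omega

theorem potentiallyHasBook_of_le_sum_vdeg (h0 : ∀ v ∉ S, vdeg G v = 0) (hS : 5 ≤ S.card)
    (hsum : 4 * S.card ≤ ∑ v, vdeg G v + 2) (hex : S.card = 6 → ∃ v ∈ S, vdeg G v ≠ 4) :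
    PotentiallyHasBook 3 (vdeg G) := by
  classical
  obtain ⟨n, hn⟩ : ∃ n, S.card = n := ⟨_, rfl⟩
  rw [hn] at hS
  induction n, hS using Nat.le_induction generalizing S G with
  | base => exact (hasBook_of_card_eq hn h0 (by omega)).potentially
  | succ n hn5 ih =>
    obtain ⟨u, hu, hmin⟩ := Finset.exists_min_image S (vdeg G) (Finset.card_pos.1 (by omega))
    have hcard : (S.erase u).card = n := by rw [Finset.card_erase_of_mem hu, hn]; rfl
    have hlow : (n + 1) * vdeg G u ≤ ∑ v, vdeg G v := by
      rw [← sum_vdeg_eq_sum_vdeg h0, ← hn, ← smul_eq_mul]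
      exact Finset.card_nsmul_le_sum S (vdeg G) _ hmin
    by_cases hdel : 4 * n + 2 * vdeg G u ≤ ∑ v, vdeg G v + 2
    · have hdelSum := sum_vdeg_deleteIncidenceSet G u
      have h0' (v : V) : v ∉ S.erase u → vdeg (G.deleteIncidenceSet u) v = 0 :=
        vdeg_deleteIncidenceSet_eq_zero h0
      by_cases hreg : n = 6 ∧ ∀ v ∈ S.erase u, vdeg (G.deleteIncidenceSet u) v = 4
      · obtain ⟨rfl, hreg⟩ := hreg
        rw [← sum_vdeg_eq_sum_vdeg h0', Finset.sum_congr rfl hreg, Finset.sum_const, hcard,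
          smul_eq_mul] at hdelSum
        exact potentiallyHasBook_of_deleteIncidenceSet_regular hn hu h0 hreg (by omega) (by omega)
      · refine .of_deleteIncidenceSet (ih h0' (by omega) (fun h => ?_) hcard)
        by_contra! hcon
        exact hreg ⟨hcard.symm.trans h, hcon⟩
    · rw [sum_vdeg_eq_two_mul_ncard_edgeSet] at hlow hdel
      rw [hn, sum_vdeg_eq_two_mul_ncard_edgeSet] at hsum
      rcases eq_three_or_eq_four_of_sum_lt (by omega) hlow hsum (by omega) with
        ⟨h3, hsum3⟩ | ⟨h4, hsum4⟩
      · rw [← sum_vdeg_eq_two_mul_ncard_edgeSet, ← hn] at hsum3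
        exact potentiallyHasBook_of_vdeg_eq_three h3 (by omega) h0
          (fun v hv => h3.symm.trans_le (hmin v hv)) hsum3
          fun K h8 hK hKsum => ih hK (by omega) (by omega) hcard
      · have hall : ∀ v ∈ S, 4 = vdeg G v := by
          refine (Finset.sum_eq_sum_iff_of_le fun v hv => h4.symm.trans_le (hmin v hv)).1 ?_
          rw [Finset.sum_const, smul_eq_mul, sum_vdeg_eq_sum_vdeg h0,
            sum_vdeg_eq_two_mul_ncard_edgeSet, hsum4, hn, mul_comm]
        have hne6 : S.card ≠ 6 := fun h6 => by
          obtain ⟨v, hv, hv4⟩ := hex h6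
          exact hv4 (hall v hv).symm
        exact potentiallyHasBook_of_eq_four (by omega) h0 fun v hv => (hall v hv).symm

end Main

section Sigma

lemma hasRealizationContaining_k311_iff {n : ℕ} {d : Fin n → ℕ} :
    HasRealizationContaining K311 d ↔ PotentiallyHasBook 3 d := by
  simp only [HasRealizationContaining, PotentiallyHasBook, isRealization_iff_vdeg_eq,
    k311_isContained_iff_hasBook]

lemma hasRealizationContaining_of_le_sum {n : ℕ} {d : Fin n → ℕ} (hn : 5 ≤ n) (hd : IsGraphic d)
    (hsum : 4 * n ≤ ∑ i, d i + 2) (hex : n = 6 → ∃ i, d i ≠ 4) :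
    HasRealizationContaining K311 d := by
  obtain ⟨-, G, hG⟩ := hd
  obtain rfl := isRealization_iff_vdeg_eq.1 hG
  exact hasRealizationContaining_k311_iff.2 (potentiallyHasBook_of_le_sum_vdeg
    (S := Finset.univ) (by simp) (by simpa using hn) (by simpa using hsum) (by simpa using hex))

lemma hasRealizationContaining_or_eq_four {d : Fin 6 → ℕ} (hd : IsGraphic d)
    (hsum : 22 ≤ ∑ i, d i) : HasRealizationContaining K311 d ∨ d = fun _ => 4 := by
  by_cases h : ∃ i, d i ≠ 4
  · exact .inl (hasRealizationContaining_of_le_sum (by norm_num) hd (by omega) fun _ => h)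
  · push Not at h
    exact .inr (funext h)

/-- The wheel with hub `0` and `m` spokes, for `3 ≤ m`. -/
def wheel (m : ℕ) : SimpleGraph (Fin (m + 1)) :=
  (cycleGraph m).map (Fin.succEmb m) ⊔ starGraph 0

/-- The degree sequence of the wheel with `m` spokes, for `3 ≤ m`. -/
def wheelSeq (m : ℕ) : Fin (m + 1) → ℕ :=
  Fin.cons m fun _ => 3

lemma vdeg_starGraph_zero (m : ℕ) :
    vdeg (starGraph (0 : Fin (m + 1))) = Fin.cons m fun _ => 1 := by
  funext i
  induction i using Fin.cases with
  | zero => exact (vdeg_eq_degree _).trans (degree_starGraph_center.trans (by simp))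
  | succ i => exact (vdeg_eq_degree _).trans (degree_starGraph_of_ne_center i.succ_ne_zero)

lemma vdeg_wheel {m : ℕ} (hm : 3 ≤ m) : vdeg (wheel m) = wheelSeq m := by
  have hdisj : Disjoint ((cycleGraph m).map (Fin.succEmb m)) (starGraph 0) := by
    rw [disjoint_left]
    rintro _ _ ⟨-, i, j, -, rfl, rfl⟩
    simp
  rw [wheel, vdeg_sup hdisj, vdeg_starGraph_zero]
  funext i
  induction i using Fin.cases with
  | zero =>
    have hhub : vdeg ((cycleGraph m).map (Fin.succEmb m)) 0 = 0 :=
      vdeg_map_of_notMem_range _ _ (by simp)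
    simpa [wheelSeq] using hhub
  | succ i =>
    obtain ⟨l, rfl⟩ := Nat.exists_eq_add_of_le' hm
    have hi := vdeg_map (cycleGraph (l + 3)) (Fin.succEmb (l + 3)) i
    rw [vdeg_eq_degree i, cycleGraph_degree_three_le] at hi
    simpa [wheelSeq] using hi

lemma isGraphic_wheelSeq {m : ℕ} (hm : 3 ≤ m) : IsGraphic (wheelSeq m) := by
  refine ⟨?_, wheel m, isRealization_iff_vdeg_eq.2 (vdeg_wheel hm)⟩
  intro i j hij
  induction i using Fin.cases with
  | zero => induction j using Fin.cases <;> simp [wheelSeq, hm]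
  | succ i =>
    induction j using Fin.cases with
    | zero => exact absurd hij (by simp)
    | succ j => simp [wheelSeq]

lemma sum_wheelSeq (m : ℕ) : ∑ i, wheelSeq m i = 4 * m := by
  rw [wheelSeq, Fin.sum_cons, Finset.sum_const, Finset.card_fin, smul_eq_mul]
  ring

lemma not_hasRealizationContaining_wheelSeq (m : ℕ) :
    ¬ HasRealizationContaining K311 (wheelSeq m) := by
  rw [hasRealizationContaining_k311_iff]
  rintro ⟨G, hG, hbook⟩
  have hub {i : Fin (m + 1)} (hi : 3 < vdeg G i) : i = 0 := by
    induction i using Fin.cases with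
    | zero => rfl
    | succ i => simp [hG, wheelSeq] at hi
  obtain ⟨a, b, hab, ha, hb⟩ := hbook.exists_lt_vdeg
  exact hab ((hub ha).trans (hub hb).symm)

lemma isGraphic_444444 : IsGraphic fun _ : Fin 6 => 4 :=
  ⟨antitone_const, fromEdgeSet (V := Fin 6) ({s(0, 2), s(0, 3), s(0, 4), s(0, 5), s(1, 2), s(1, 3),
      s(1, 4), s(1, 5), s(2, 4), s(2, 5), s(3, 4), s(3, 5)} : Finset (Sym2 (Fin 6))),
    fun v => (vdeg_eq_degree v).trans (by decide +revert)⟩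

lemma not_hasRealizationContaining_444444 :
    ¬ HasRealizationContaining K311 fun _ : Fin 6 => 4 := by
  rw [hasRealizationContaining_k311_iff]
  rintro ⟨G, hG, hbook⟩
  exact not_hasBook_of_vdeg_eq (Fintype.card_fin 6) (congrFun hG) hbook

lemma sigma_k311 {n : ℕ} (hn : n = 5 ∨ 7 ≤ n) : sigma K311 n = 4 * n - 2 := by
  refine (sigma_isLeast K311 n).unique ⟨⟨⟨2 * n - 1, by omega⟩, fun d hd _ hsum =>
    hasRealizationContaining_of_le_sum (by omega) hd (by omega) (by omega)⟩, ?_⟩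
  rintro l ⟨⟨j, rfl⟩, hl⟩
  by_contra! hlt
  obtain ⟨m, rfl⟩ : ∃ m, n = m + 1 := ⟨n - 1, by omega⟩
  refine not_hasRealizationContaining_wheelSeq m (hl _ (isGraphic_wheelSeq (by omega)) ?_
    (by rw [sum_wheelSeq]; omega))
  have hm : 0 < m := by omega
  simpa [Fin.forall_fin_succ, wheelSeq] using hm

lemma sigma_k311_six : sigma K311 6 = 26 := by
  refine (sigma_isLeast K311 6).unique ⟨⟨by decide, fun d hd _ hsum => ?_⟩, ?_⟩
  · refine (hasRealizationContaining_or_eq_four hd (by omega)).resolve_right ?_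
    rintro rfl
    norm_num at hsum
  · rintro l ⟨⟨j, rfl⟩, hl⟩
    by_contra! hlt
    exact not_hasRealizationContaining_444444 (hl _ isGraphic_444444 (by simp) (by
      rw [Finset.sum_const, Finset.card_fin, smul_eq_mul]
      omega))

end Sigma

theorem theorem4p4 :
    (∀ n : ℕ, n = 5 ∨ 7 ≤ n → sigma K311 n = 4 * n - 2) ∧
    (∀ d : Fin 6 → ℕ, IsGraphic d → 22 ≤ ∑ i, d i →
      HasRealizationContaining K311 d ∨ d = fun _ => 4) ∧
    sigma K311 6 = 26 :=
  ⟨fun _ hn => sigma_k311 hn, fun _ hd hsum => hasRealizationContaining_or_eq_four hd hsum,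
    sigma_k311_six⟩
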